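/- Let $r>1$ and $m\ge 0$ be integers with $r\not\equiv 0\pmod 4$. Let $Cl_r$ be the real Clifford algebra generated by the standard basis $e_1,\dots,e_r$ of $\mathbb{R}^r$ subject to $e_je_k+e_ke_j=-2\delta_{jk}$, let $Cl_r^0$ be its even subalgebra, and let $\mathfrak{spin}(r)=\operatorname{span}_{\mathbb{R}}\{e_ie_j : 1\le i<j\le r\}\subset Cl_r^0$, a Lie algebra under the commutator. Let $\tilde\Delta_r$ be an irreducible real $Cl_r^0$-module and let $d_r=\dim_{\mathbb{R}}\tilde\Delta_r$. Choose a linear identification $\psi:\tilde\Delta_r\otimes_{\mathbb{R}}\mathbb{R}^m\to\mathbb{R}^{d_rm}$ such that, for all $i<j$, the endomorphism of $\mathbb{R}^{d_rm}$ corresponding under $\psi$ to $e_ie_j\otimes\mathrm{Id}_{m\times m}$ is antisymmetric for the standard inner product, and let $\widehat{\mathfrak{spin}(r)}\subset\mathfrak{so}(d_rm)$ be the image of $\mathfrak{spin}(r)\otimes\mathrm{Id}_{m\times m}$. Then the centralizer $\{X\in\mathfrak{so}(d_rm) : [X,Y]=0 \text{ for all } Y\in\widehat{\mathfrak{spin}(r)}\}$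 is isomorphic, as a real Lie algebra, to - $\mathfrak{so}(m)$ if $r\equiv\pm1\pmod 8$, - $\mathfrak{u}(m)$ (skew-Hermitian complex $m\times m$ matrices) if $r\equiv\pm2\pmod 8$, - $\mathfrak{sp}(m)$ (skew-Hermitian quaternionic $m\times m$ matrices) if $r\equiv\pm3\pmod 8$. -/

import Mathlib

open scoped TensorProduct Matrix Quaternion

attribute [local instance 100] LieRing.ofAssociativeRing

namespace SpinCentralizer

noncomputable section

/-- The quadratic form `-(x₁² + ⋯ + x_r²)` on `ℝ^r`; its Clifford algebra is generated by the
standard basis vectors subject to `e_j e_k + e_k e_j = -2 δ_{jk}`. -/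
def negSumSq (r : ℕ) : QuadraticForm ℝ (Fin r → ℝ) :=
  QuadraticMap.weightedSumSquares ℝ (fun _ : Fin r => (-1 : ℝ))

/-- The even Clifford algebra `Cl_r^0`. -/
abbrev EvenCl (r : ℕ) : Type := CliffordAlgebra.even (negSumSq r)

/-- The product `e_i e_j` of two standard basis vectors, as an element of `Cl_r^0`. -/
def bivec {r : ℕ} (i j : Fin r) : EvenCl r :=
  (CliffordAlgebra.even.ι (negSumSq r)).bilin (Pi.single i 1) (Pi.single j 1)

theorem negSumSq_single {r : ℕ} (i : Fin r) : negSumSq r (Pi.single i 1) = -1 := by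
  simp [negSumSq, QuadraticMap.weightedSumSquares_apply, Pi.single_apply]

theorem coe_bivec {r : ℕ} (i j : Fin r) :
    (bivec i j : CliffordAlgebra (negSumSq r)) =
      CliffordAlgebra.ι (negSumSq r) (Pi.single i 1) *
        CliffordAlgebra.ι (negSumSq r) (Pi.single j 1) := rfl

theorem bivec_swap {r : ℕ} {i j : Fin r} (h : i ≠ j) : bivec j i = -bivec i j := by
  apply Subtype.ext
  have h2 : QuadraticMap.polar (negSumSq r) (Pi.single j 1) (Pi.single i 1) = 0 := by
    simp only [QuadraticMap.polar, negSumSq, QuadraticMap.weightedSumSquares_apply, Pi.add_apply]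
    rw [← Finset.sum_sub_distrib, ← Finset.sum_sub_distrib]
    refine Finset.sum_eq_zero fun x _ => ?_
    by_cases hx : x = i
    · subst hx
      simp [h]
    · simp [hx]
  have h1 := CliffordAlgebra.ι_mul_ι_add_swap (Q := negSumSq r) (Pi.single j 1) (Pi.single i 1)
  rw [h2, map_zero] at h1
  exact eq_neg_of_add_eq_zero_left h1

theorem bivec_mul {r : ℕ} (i j k : Fin r) : bivec i j * bivec j k = -bivec i k := by
  have h := (CliffordAlgebra.even.ι (negSumSq r)).contract_mid
    (Pi.single i 1) (Pi.single j 1) (Pi.single k 1)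
  rw [negSumSq_single, neg_one_smul] at h
  exact h

/-- The linear span of the `e_i e_j` with `i < j`. -/
def spinSpan (r : ℕ) : Submodule ℝ (EvenCl r) :=
  Submodule.span ℝ {x | ∃ i j : Fin r, i < j ∧ x = bivec i j}

theorem bivec_mem {r : ℕ} {i j : Fin r} (h : i ≠ j) : bivec i j ∈ spinSpan r := by
  rcases lt_or_gt_of_ne h with h' | h'
  · exact Submodule.subset_span ⟨i, j, h', rfl⟩
  · rw [bivec_swap h.symm]
    exact neg_mem (Submodule.subset_span ⟨j, i, h', rfl⟩)

theorem bivec_comm_mem_of_shared {r : ℕ} {i j k : Fin r} (hij : i ≠ j) (hjk : j ≠ k) :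
    bivec i j * bivec j k - bivec j k * bivec i j ∈ spinSpan r := by
  have e : bivec j k * bivec i j = -bivec k i := by
    rw [bivec_swap hjk.symm, bivec_swap hij.symm, neg_mul_neg, bivec_mul]
  rw [e, bivec_mul]
  by_cases hik : i = k
  · subst hik
    simp
  · rw [bivec_swap hik]
    have := bivec_mem hik
    exact sub_mem (neg_mem this) (neg_mem (neg_mem this))

theorem bivec_comm_mem {r : ℕ} {i j k l : Fin r} (hij : i ≠ j) (hkl : k ≠ l) :
    bivec i j * bivec k l - bivec k l * bivec i j ∈ spinSpan r := by
  by_cases hjk : j = k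
  · subst hjk
    exact bivec_comm_mem_of_shared hij hkl
  by_cases hik : i = k
  · subst hik
    have := neg_mem (bivec_comm_mem_of_shared hij.symm hkl)
    rw [bivec_swap hij.symm]
    convert this using 1
    noncomm_ring
  by_cases hjl : j = l
  · subst hjl
    have := neg_mem (bivec_comm_mem_of_shared hij hkl.symm)
    rw [bivec_swap hkl.symm]
    convert this using 1
    noncomm_ring
  by_cases hil : i = l
  · subst hil
    have := bivec_comm_mem_of_shared hij.symm hkl.symm
    rw [bivec_swap hkl.symm, bivec_swap hij.symm, neg_mul_neg, neg_mul_neg]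
    exact this
  have key : ∀ a b c d : Fin r, b ≠ c → bivec a b * bivec c d = -(bivec a c * bivec b d) := by
    intro a b c d hbc
    have h1 : bivec a b = -(bivec a c * bivec c b) := by rw [bivec_mul, neg_neg]
    have h2 : bivec b c * bivec c d = -bivec b d := bivec_mul b c d
    rw [h1, bivec_swap hbc, mul_neg, neg_neg, mul_assoc, h2, mul_neg]
  have : bivec i j * bivec k l - bivec k l * bivec i j = 0 := by
    rw [key i j k l hjk, key k l i j (Ne.symm hil), bivec_swap hik, bivec_swap hjl, neg_mul_neg,
      sub_self]
  rw [this]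
  exact zero_mem _

/-- The Lie algebra `spin(r) = span {e_i e_j : i < j} ⊆ Cl_r^0`, with the commutator bracket. -/
def spin (r : ℕ) : LieSubalgebra ℝ (EvenCl r) where
  __ := spinSpan r
  lie_mem' := by
    intro x y hx hy
    change x ∈ spinSpan r at hx
    change y ∈ spinSpan r at hy
    change x * y - y * x ∈ spinSpan r
    refine Submodule.span_induction₂ (p := fun x y _ _ => x * y - y * x ∈ spinSpan r)
      ?_ ?_ ?_ ?_ ?_ ?_ ?_ hx hy
    · rintro _ _ ⟨i, j, hij, rfl⟩ ⟨k, l, hkl, rfl⟩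
      exact bivec_comm_mem hij.ne hkl.ne
    · intro y _
      simp
    · intro x _
      simp
    · intro x y z _ _ _ h1 h2
      convert add_mem h1 h2 using 1
      noncomm_ring
    · intro x y z _ _ _ h1 h2
      convert add_mem h1 h2 using 1
      noncomm_ring
    · intro c x y _ _ h
      convert (spinSpan r).smul_mem c h using 1
      rw [smul_sub, smul_mul_assoc, mul_smul_comm]
    · intro c x y _ _ h
      convert (spinSpan r).smul_mem c h using 1
      rw [smul_sub, smul_mul_assoc, mul_smul_comm]

/-- The representation of `Cl_r^0` by real `N × N` matrices obtained from the diagonal action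
`x ↦ x ⊗ Id` on `Δ ⊗ ℝ^m` and a linear identification `ψ` of `Δ ⊗ ℝ^m` with `ℝ^N`. -/
def diagRep {r m N : ℕ} {Δ : Type*} [AddCommGroup Δ] [Module ℝ Δ] [Module (EvenCl r) Δ]
    [IsScalarTower ℝ (EvenCl r) Δ] (ψ : (Δ ⊗[ℝ] (Fin m → ℝ)) ≃ₗ[ℝ] (Fin N → ℝ)) :
    EvenCl r →ₐ[ℝ] Matrix (Fin N) (Fin N) ℝ :=
  (LinearMap.toMatrixAlgEquiv' : ((Fin N → ℝ) →ₗ[ℝ] (Fin N → ℝ)) ≃ₐ[ℝ] _).toAlgHom.comp <|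
    (ψ.conjAlgEquiv ℝ).toAlgHom.comp <|
      (Module.End.rTensorAlgHom ℝ Δ (Fin m → ℝ)).comp (Algebra.lsmul ℝ ℝ Δ)

/-- The diagonal copy `spin(r) ⊗ Id_m` of `spin(r)` inside the real `N × N` matrices. -/
def spinHat {r m N : ℕ} {Δ : Type*} [AddCommGroup Δ] [Module ℝ Δ] [Module (EvenCl r) Δ]
    [IsScalarTower ℝ (EvenCl r) Δ] (ψ : (Δ ⊗[ℝ] (Fin m → ℝ)) ≃ₗ[ℝ] (Fin N → ℝ)) :
    LieSubalgebra ℝ (Matrix (Fin N) (Fin N) ℝ) :=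
  (spin r).map (diagRep ψ).toLieHom

/-- The centralizer of `h` in `g`, for Lie subalgebras `g` and `h` of a Lie algebra `L`. -/
def centralizerIn {L : Type*} [LieRing L] [LieAlgebra ℝ L] (g h : LieSubalgebra ℝ L) :
    LieSubalgebra ℝ L where
  carrier := {x | x ∈ g ∧ ∀ y ∈ h, ⁅x, y⁆ = 0}
  add_mem' := fun {a b} ha hb =>
    ⟨add_mem ha.1 hb.1, fun y hy => by rw [add_lie, ha.2 y hy, hb.2 y hy, add_zero]⟩
  zero_mem' := ⟨zero_mem _, fun y _ => zero_lie y⟩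
  smul_mem' := fun c x hx =>
    ⟨g.smul_mem c hx.1, fun y hy => by rw [smul_lie, hx.2 y hy, smul_zero]⟩
  lie_mem' := fun {a b} ha hb =>
    ⟨g.lie_mem ha.1 hb.1, fun y hy => by
      rw [lie_lie, ha.2 y hy, hb.2 y hy, lie_zero, lie_zero, sub_zero]⟩

/-- The real Lie algebra of skew-Hermitian `m × m` matrices over a real `*`-algebra `A`. -/
def skewHermitian (m : ℕ) (A : Type*) [Ring A] [StarRing A] [Algebra ℝ A] [StarModule ℝ A] :
    LieSubalgebra ℝ (Matrix (Fin m) (Fin m) A) where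
  carrier := {X | Xᴴ = -X}
  add_mem' := fun {X Y} hX hY => by
    change (X + Y)ᴴ = -(X + Y)
    rw [Matrix.conjTranspose_add, show Xᴴ = -X from hX, show Yᴴ = -Y from hY, neg_add]
  zero_mem' := by simp
  smul_mem' := fun c X hX => by
    change (c • X)ᴴ = -(c • X)
    rw [Matrix.conjTranspose_smul, show Xᴴ = -X from hX, star_trivial, smul_neg]
  lie_mem' := fun {X Y} hX hY => by
    change (X * Y - Y * X)ᴴ = -(X * Y - Y * X)
    rw [Matrix.conjTranspose_sub, Matrix.conjTranspose_mul, Matrix.conjTranspose_mul,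
      show Xᴴ = -X from hX, show Yᴴ = -Y from hY]
    noncomm_ring

instance quaternionStarModule : StarModule ℝ ℍ[ℝ] :=
  ⟨fun c x => by rw [star_trivial c]; exact Quaternion.star_smul c x⟩

/-- The Lie algebra `u(m)` of skew-Hermitian complex matrices. -/
abbrev u (m : ℕ) : LieSubalgebra ℝ (Matrix (Fin m) (Fin m) ℂ) := skewHermitian m ℂ

/-- The compact symplectic Lie algebra `sp(m)` of skew-Hermitian quaternionic matrices. -/
abbrev sp (m : ℕ) : LieSubalgebra ℝ (Matrix (Fin m) (Fin m) ℍ[ℝ]) := skewHermitian m ℍ[ℝ]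

end

end SpinCentralizer

/-!
Write `D` for the algebra of endomorphisms of `Δ` that commute with the even Clifford algebra. The
elements `e₀ eᵢ`, for `i > 0`, generate the even Clifford algebra
(`commute_of_commute_bivec_zero`), square to `-1` and anticommute, so everything depends only on the
`r - 1` matrices by which they act.

*The real form of `D`.* Pulling back the inner product of `ℝ^N` along one summand of `Δ ⊗ ℝ^m` makes
these matrices skew, so `D` is closed under transposition. A symmetric element of `D` has a real
eigenvalue, whose eigenspace is a submodule of the simple module `Δ`; hence it is a scalar
(`exists_eq_smul_one_of_symmetric`). The dimension of `D` is then found by a Frobenius–Schur count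
(`finrank_commutant`). Conjugation averaged over all products of the `J i = e₀ eᵢ` projects the
matrix algebra onto `D`, and symmetrizing the result projects it onto the scalars, a projection of
trace 1. The trace of the projection onto `D` followed by transposition is the average of the traces
of the squares of these products, that is, of signs times `dim Δ`; the signs add up to
`Re (1 + i) ^ r`. Comparing traces gives
`dim D = 2 - (dim Δ / 2 ^ (r - 1)) * Re (1 + i) ^ r`.
The sign of `Re (1 + i) ^ r` depends on `r` modulo 8 only, and so `dim D` is less than, equal to, or
greater than two in the three cases. As the symmetric elements are scalars, `D` is accordingly `ℝ`,
`ℂ` or `ℍ`, with transposition as the conjugation (`exists_model_real`, `exists_model_complex`,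
`exists_model_quaternion`).

*The centralizer.* For an equivariant map `S : Δ → ℝ^N` the product `Sᵀ S` is a symmetric element of
`D`, hence a scalar, so the Gram–Schmidt process applies to the `m` summands of `Δ ⊗ ℝ^m` and makes
`ℝ^N` an orthogonal sum of `m` isometric copies of `Δ` (`exists_orthonormal_intertwiners`). In this
decomposition the matrices that commute with `spin(r) ⊗ Id` are the `m × m` matrices over `D`, with
transposition corresponding to the conjugate transpose, and the skew ones are the skew-Hermitian
matrices over `D` (`nonempty_lieEquiv_skewHermitian`).
-/

namespace SpinCentralizer

/-! ### Averaging over products of anticommuting complex structures -/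

section Averaging

variable {ι : Type*} [Fintype ι] [DecidableEq ι]

/-- For pairwise anticommuting `J₁, …, Jₙ` with `Jₖ² = -1`, the sum of the conjugates
`J_S A J_S⁻¹` of a matrix `A` over all products `J_S` of distinct members of the list. The
recursion uses `Jₖ⁻¹ = -Jₖ`. -/
noncomputable def conjSum : List (Matrix ι ι ℝ) → (Matrix ι ι ℝ →ₗ[ℝ] Matrix ι ι ℝ)
  | [] => LinearMap.id
  | J :: l => conjSum l - (LinearMap.mulRight ℝ J ∘ₗ LinearMap.mulLeft ℝ J) ∘ₗ conjSum l

theorem conjSum_cons_apply (J : Matrix ι ι ℝ) (l : List (Matrix ι ι ℝ)) (A : Matrix ι ι ℝ) :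
    conjSum (J :: l) A = conjSum l A - J * conjSum l A * J := rfl

theorem commute_conjSum {l : List (Matrix ι ι ℝ)} (hsq : ∀ J ∈ l, J * J = -1)
    (hanti : l.Pairwise fun J K => J * K = -(K * J)) (A : Matrix ι ι ℝ) :
    ∀ J ∈ l, J * conjSum l A = conjSum l A * J := by
  induction l with
  | nil => simp
  | cons J l ih =>
    rw [List.pairwise_cons] at hanti
    have ih' := ih (fun K hK => hsq K (List.mem_cons_of_mem _ hK)) hanti.2
    have hJ := hsq J List.mem_cons_self
    intro K hK
    rw [conjSum_cons_apply]
    set B := conjSum l A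
    rcases List.mem_cons.1 hK with rfl | hK
    · rw [mul_sub, sub_mul, mul_assoc (K * B), hJ, mul_assoc K B, ← mul_assoc K K, hJ]
      noncomm_ring
    · have h1 := hanti.1 K hK
      have h2 := ih' K hK
      have h3 : K * (J * B * J) = J * B * J * K := by
        calc K * (J * B * J) = -(J * K) * B * J := by rw [h1]; noncomm_ring
          _ = -(J * (K * B) * J) := by noncomm_ring
          _ = -(J * B * (K * J)) := by rw [h2]; noncomm_ring
          _ = J * B * (J * K) := by rw [h1]; noncomm_ring
          _ = J * B * J * K := by noncomm_ring
      rw [mul_sub, sub_mul, h2, h3]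

theorem conjSum_of_commute {l : List (Matrix ι ι ℝ)} (hsq : ∀ J ∈ l, J * J = -1)
    {A : Matrix ι ι ℝ} (hA : ∀ J ∈ l, J * A = A * J) :
    conjSum l A = (2 : ℝ) ^ l.length • A := by
  induction l with
  | nil => simp [conjSum]
  | cons J l ih =>
    have hJ := hsq J List.mem_cons_self
    rw [conjSum_cons_apply, ih (fun K hK => hsq K (List.mem_cons_of_mem _ hK))
      (fun K hK => hA K (List.mem_cons_of_mem _ hK)), mul_smul_comm, smul_mul_assoc,
      hA J List.mem_cons_self, mul_assoc, hJ, List.length_cons, pow_succ, mul_smul, two_smul,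
      smul_add]
    simp

/-- The linear map `A ↦ X Aᵀ Y`. -/
noncomputable def mulTransposeMul (X Y : Matrix ι ι ℝ) : Matrix ι ι ℝ →ₗ[ℝ] Matrix ι ι ℝ :=
  LinearMap.mulRight ℝ Y ∘ₗ LinearMap.mulLeft ℝ X ∘ₗ
    (Matrix.transposeLinearEquiv ι ι ℝ ℝ).toLinearMap

theorem mulTransposeMul_apply (X Y A : Matrix ι ι ℝ) : mulTransposeMul X Y A = X * Aᵀ * Y := rfl

theorem trace_mulTransposeMul (X Y : Matrix ι ι ℝ) :
    LinearMap.trace ℝ _ (mulTransposeMul X Y) = (X * Yᵀ).trace := by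
  rw [LinearMap.trace_eq_matrix_trace ℝ (Matrix.stdBasis ℝ ι ι), Matrix.trace, Matrix.trace,
    Fintype.sum_prod_type]
  refine Finset.sum_congr rfl fun i _ => ?_
  rw [Matrix.diag_apply, Matrix.mul_apply]
  refine Finset.sum_congr rfl fun j _ => ?_
  rw [Matrix.diag_apply, LinearMap.toMatrix_apply, mulTransposeMul_apply,
    Matrix.stdBasis_eq_single, Matrix.transpose_single]
  have : ∀ (M : Matrix ι ι ℝ), (Matrix.stdBasis ℝ ι ι).repr M (i, j) = M i j := by
    intro M
    simp [Matrix.stdBasis]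
  rw [this]
  simp [Matrix.mul_apply, Matrix.single_apply, ite_and]

/-- Each product `J_S` contributes `tr ((J_S X)²)` to this trace. Since `X` commutes or
anticommutes with the `J`'s, this is `±tr 1`, and along the recursion the signs add up to the real
or the imaginary part of `(1 + i) ^ (n + 1)`. -/
theorem trace_mulTransposeMul_conjSum {l : List (Matrix ι ι ℝ)} (hsq : ∀ J ∈ l, J * J = -1)
    (hskew : ∀ J ∈ l, Jᵀ = -J) (hanti : l.Pairwise fun J K => J * K = -(K * J)) :
    ∀ (X : Matrix ι ι ℝ) (t : ℝ), X * X = t • 1 →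
      ((∀ J ∈ l, X * J = J * X) → LinearMap.trace ℝ _ (mulTransposeMul X Xᵀ ∘ₗ conjSum l) =
        t * Fintype.card ι * ((1 + Complex.I) ^ (l.length + 1)).re) ∧
      ((∀ J ∈ l, X * J = -(J * X)) → LinearMap.trace ℝ _ (mulTransposeMul X Xᵀ ∘ₗ conjSum l) =
        t * Fintype.card ι * ((1 + Complex.I) ^ (l.length + 1)).im) := by
  induction l with
  | nil =>
    intro X t hX
    have : LinearMap.trace ℝ _ (mulTransposeMul X Xᵀ ∘ₗ conjSum []) = t * Fintype.card ι := by
      rw [conjSum, LinearMap.comp_id, trace_mulTransposeMul, Matrix.transpose_transpose, hX]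
      simp
    simp [this]
  | cons J l ih =>
    intro X t hX
    have ih' := ih (fun K hK => hsq K (List.mem_cons_of_mem _ hK))
      (fun K hK => hskew K (List.mem_cons_of_mem _ hK)) (List.pairwise_cons.1 hanti).2
    have hJ := hsq J List.mem_cons_self
    have hJt := hskew J List.mem_cons_self
    have hJK := (List.pairwise_cons.1 hanti).1
    have hsum : mulTransposeMul X Xᵀ ∘ₗ conjSum (J :: l) = mulTransposeMul X Xᵀ ∘ₗ conjSum l +
        mulTransposeMul (X * J) (X * J)ᵀ ∘ₗ conjSum l := by
      ext1 A
      simp only [LinearMap.comp_apply, LinearMap.add_apply, mulTransposeMul_apply,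
        conjSum_cons_apply, Matrix.transpose_sub, Matrix.transpose_mul, hJt]
      noncomm_ring
    rw [hsum, map_add]
    have hre : ((1 + Complex.I) ^ ((J :: l).length + 1)).re =
        ((1 + Complex.I) ^ (l.length + 1)).re - ((1 + Complex.I) ^ (l.length + 1)).im := by
      rw [List.length_cons, pow_succ _ (l.length + 1), Complex.mul_re]
      simp
    have him : ((1 + Complex.I) ^ ((J :: l).length + 1)).im =
        ((1 + Complex.I) ^ (l.length + 1)).re + ((1 + Complex.I) ^ (l.length + 1)).im := by
      rw [List.length_cons, pow_succ _ (l.length + 1), Complex.mul_im]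
      simp
    rw [hre, him]
    constructor
    · intro h
      have hXJ := h J List.mem_cons_self
      rw [(ih' X t hX).1 fun K hK => h K (List.mem_cons_of_mem _ hK),
        (ih' (X * J) (-t) ?_).2 ?_]
      · ring
      · calc X * J * (X * J) = X * J * (J * X) := by rw [hXJ]
          _ = X * (J * J) * X := by noncomm_ring
          _ = (-t) • 1 := by rw [hJ, neg_smul, ← hX]; noncomm_ring
      · intro K hK
        calc X * J * K = X * (J * K) := by noncomm_ring
          _ = -(X * K * J) := by rw [hJK K hK]; noncomm_ring
          _ = -(K * (X * J)) := by rw [h K (List.mem_cons_of_mem _ hK)]; noncomm_ring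
    · intro h
      have hXJ := h J List.mem_cons_self
      rw [(ih' X t hX).2 fun K hK => h K (List.mem_cons_of_mem _ hK),
        (ih' (X * J) t ?_).1 ?_]
      · ring
      · calc X * J * (X * J) = X * J * (-(J * X)) := by rw [hXJ]
          _ = -(X * (J * J) * X) := by noncomm_ring
          _ = t • 1 := by rw [hJ, ← hX]; noncomm_ring
      · intro K hK
        calc X * J * K = X * (J * K) := by noncomm_ring
          _ = -(X * K * J) := by rw [hJK K hK]; noncomm_ring
          _ = K * (X * J) := by rw [h K (List.mem_cons_of_mem _ hK)]; noncomm_ring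

/-- The commutant of a family of matrices. -/
abbrev commutant {κ : Type*} (J : κ → Matrix ι ι ℝ) : Subalgebra ℝ (Matrix ι ι ℝ) :=
  Subalgebra.centralizer ℝ (Set.range J)

theorem mem_commutant {κ : Type*} {J : κ → Matrix ι ι ℝ} {A : Matrix ι ι ℝ} :
    A ∈ commutant J ↔ ∀ i, J i * A = A * J i := by
  simp [commutant, Subalgebra.mem_centralizer_iff]

theorem transpose_mem_commutant {κ : Type*} {J : κ → Matrix ι ι ℝ} (hskew : ∀ i, (J i)ᵀ = -J i)
    {A : Matrix ι ι ℝ} (hA : A ∈ commutant J) : Aᵀ ∈ commutant J := by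
  rw [mem_commutant] at hA ⊢
  intro i
  have := congrArg Matrix.transpose (hA i)
  rw [Matrix.transpose_mul, Matrix.transpose_mul, hskew, mul_neg, neg_mul, neg_inj] at this
  exact this.symm

/-- A form of the Frobenius–Schur count: `2⁻ⁿ • conjSum` projects onto the commutant, and its
symmetrization projects onto the scalars, so comparing traces gives the dimension of the
commutant. -/
theorem finrank_commutant [Nonempty ι] {n : ℕ} {J : Fin n → Matrix ι ι ℝ}
    (hsq : ∀ i, J i * J i = -1) (hskew : ∀ i, (J i)ᵀ = -J i)
    (hanti : ∀ i j, i ≠ j → J i * J j = -(J j * J i))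
    (hsymm : ∀ A ∈ commutant J, Aᵀ = A → ∃ c : ℝ, A = c • 1) :
    (Module.finrank ℝ (commutant J) : ℝ) =
      2 - Fintype.card ι * ((1 + Complex.I) ^ (n + 1)).re / 2 ^ n := by
  set l := List.ofFn J with hl
  have hlen : l.length = n := by simp [hl]
  have hmem : ∀ K, K ∈ l ↔ ∃ i, J i = K := fun K => by simp [hl, List.mem_ofFn]
  have hlsq : ∀ K ∈ l, K * K = -1 := fun K hK => by
    obtain ⟨i, rfl⟩ := (hmem K).1 hK; exact hsq i
  have hlskew : ∀ K ∈ l, Kᵀ = -K := fun K hK => by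
    obtain ⟨i, rfl⟩ := (hmem K).1 hK; exact hskew i
  have hlanti : l.Pairwise fun K L => K * L = -(L * K) :=
    List.pairwise_ofFn.2 fun i j hij => hanti i j hij.ne
  have hcomm : ∀ A, A ∈ commutant J ↔ ∀ K ∈ l, K * A = A * K := fun A => by
    rw [mem_commutant]
    exact ⟨fun h K hK => by obtain ⟨i, rfl⟩ := (hmem K).1 hK; exact h i,
      fun h i => h _ ((hmem _).2 ⟨i, rfl⟩)⟩
  have h2 : (2 : ℝ) ^ n ≠ 0 := by positivity
  set P : Matrix ι ι ℝ →ₗ[ℝ] Matrix ι ι ℝ := ((2 : ℝ) ^ n)⁻¹ • conjSum l with hP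
  have hPmem : ∀ A, P A ∈ commutant J := fun A =>
    (commutant J).smul_mem ((hcomm _).2 (commute_conjSum hlsq hlanti A)) _
  have hPid : ∀ A ∈ commutant J, P A = A := fun A hA => by
    rw [hP, LinearMap.smul_apply, conjSum_of_commute hlsq ((hcomm A).1 hA), hlen, smul_smul,
      inv_mul_cancel₀ h2, one_smul]
  have hproj : LinearMap.IsProj (Subalgebra.toSubmodule (commutant J)) P := ⟨hPmem, hPid⟩
  set T : Matrix ι ι ℝ →ₗ[ℝ] Matrix ι ι ℝ := (Matrix.transposeLinearEquiv ι ι ℝ ℝ).toLinearMap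
  have hT : ∀ A, T A = Aᵀ := fun _ => rfl
  have hproj' : LinearMap.IsProj (ℝ ∙ (1 : Matrix ι ι ℝ)) ((2 : ℝ)⁻¹ • (P + T ∘ₗ P)) := by
    refine ⟨fun A => ?_, fun A hA => ?_⟩
    · have hS : (2 : ℝ)⁻¹ • (P A + (P A)ᵀ) ∈ commutant J := (commutant J).smul_mem
        (add_mem (hPmem A) (transpose_mem_commutant hskew (hPmem A))) _
      obtain ⟨c, hc⟩ := hsymm _ hS (by simp [add_comm])
      exact Submodule.mem_span_singleton.2 ⟨c, hc.symm⟩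
    · obtain ⟨c, rfl⟩ := Submodule.mem_span_singleton.1 hA
      have : P (c • 1) = c • 1 := hPid _ ((commutant J).smul_mem (one_mem _) _)
      rw [LinearMap.smul_apply, LinearMap.add_apply, LinearMap.comp_apply, this, hT,
        Matrix.transpose_smul, Matrix.transpose_one, ← two_smul ℝ (c • (1 : Matrix ι ι ℝ))]
      rw [smul_smul, inv_mul_cancel₀ two_ne_zero, one_smul]
  have e1 := hproj.trace
  have e2 := hproj'.trace
  rw [finrank_span_singleton (one_ne_zero)] at e2
  have e3 : LinearMap.trace ℝ _ (T ∘ₗ P) =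
      ((2 : ℝ) ^ n)⁻¹ * (Fintype.card ι * ((1 + Complex.I) ^ (n + 1)).re) := by
    have : T ∘ₗ P = ((2 : ℝ) ^ n)⁻¹ • (mulTransposeMul 1 1ᵀ ∘ₗ conjSum l) := by
      ext1 A
      simp [hP, T, mulTransposeMul_apply]
    rw [this, map_smul, ((trace_mulTransposeMul_conjSum hlsq hlskew hlanti 1 1 (by simp)).1
      (by simp)), hlen]
    simp
  rw [map_smul, map_add, e1, e3] at e2
  change _ = (Module.finrank ℝ (Subalgebra.toSubmodule (commutant J)) : ℝ) at e1
  have e4 : Module.finrank ℝ (commutant J) =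
    Module.finrank ℝ (Subalgebra.toSubmodule (commutant J)) := rfl
  rw [e4]
  simp only [smul_eq_mul, Nat.cast_one] at e2
  field_simp at e2 ⊢
  linarith

end Averaging

/-! ### The commutant as a star algebra -/

theorem pos_of_transpose_mul_self {ι κ : Type*} [Fintype ι] [Fintype κ] [DecidableEq κ]
    [Nonempty κ] {S : Matrix ι κ ℝ} (hS : S ≠ 0) {s : ℝ} (h : Sᵀ * S = s • 1) : 0 < s := by
  obtain ⟨k⟩ := ‹Nonempty κ›
  have h0 : 0 ≤ s := by
    have := congrFun (congrFun h k) k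
    rw [Matrix.mul_apply] at this
    simp only [Matrix.transpose_apply, Matrix.smul_apply, Matrix.one_apply_eq, smul_eq_mul,
      mul_one] at this
    rw [← this]
    exact Finset.sum_nonneg fun i _ => mul_self_nonneg _
  refine lt_of_le_of_ne h0 fun hs => hS ?_
  rw [← hs, zero_smul, ← Matrix.conjTranspose_eq_transpose_of_trivial] at h
  exact Matrix.conjTranspose_mul_self_eq_zero.1 h

section StarAlgebra

variable {ι κ : Type*} [Fintype ι] [DecidableEq ι] {J : κ → Matrix ι ι ℝ}

theorem exists_smul_sq_eq_neg_one [Nonempty ι]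
    (hsymm : ∀ A ∈ commutant J, Aᵀ = A → ∃ c : ℝ, A = c • 1)
    {B : Matrix ι ι ℝ} (hB : B ∈ commutant J) (hBt : Bᵀ = -B) (hB0 : B ≠ 0) :
    ∃ c : ℝ, (c • B) * (c • B) = -1 := by
  obtain ⟨s, hs⟩ := hsymm (Bᵀ * B) (by rw [hBt]; exact mul_mem (neg_mem hB) hB)
    (by rw [Matrix.transpose_mul, Matrix.transpose_transpose])
  have hpos := pos_of_transpose_mul_self hB0 hs
  refine ⟨(√s)⁻¹, ?_⟩
  rw [hBt, neg_mul, neg_eq_iff_eq_neg] at hs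
  rw [smul_mul_smul_comm, hs, ← mul_inv, Real.mul_self_sqrt hpos.le, smul_neg, smul_smul,
    inv_mul_cancel₀ hpos.ne', one_smul]

theorem exists_eq_smul_one_add_skew (hskew : ∀ i, (J i)ᵀ = -J i)
    (hsymm : ∀ A ∈ commutant J, Aᵀ = A → ∃ c : ℝ, A = c • 1)
    {A : Matrix ι ι ℝ} (hA : A ∈ commutant J) :
    ∃ (c : ℝ) (B : Matrix ι ι ℝ), B ∈ commutant J ∧ Bᵀ = -B ∧ A = c • 1 + B := by
  have hAt := transpose_mem_commutant hskew hA
  obtain ⟨c, hc⟩ := hsymm ((2 : ℝ)⁻¹ • (A + Aᵀ)) ((commutant J).smul_mem (add_mem hA hAt) _)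
    (by simp [add_comm])
  refine ⟨c, (2 : ℝ)⁻¹ • (A - Aᵀ), (commutant J).smul_mem (sub_mem hA hAt) _, ?_, ?_⟩
  · rw [Matrix.transpose_smul, Matrix.transpose_sub, Matrix.transpose_transpose, ← smul_neg,
      neg_sub]
  · rw [← hc, ← smul_add, add_add_sub_cancel, ← two_smul ℝ A, smul_smul,
      inv_mul_cancel₀ two_ne_zero, one_smul]

/-- Orthogonalization of a skew element of the commutant against a complex structure. -/
theorem exists_add_smul_anticommute
    (hsymm : ∀ A ∈ commutant J, Aᵀ = A → ∃ c : ℝ, A = c • 1) {B I : Matrix ι ι ℝ}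
    (hB : B ∈ commutant J) (hBt : Bᵀ = -B) (hI : I ∈ commutant J) (hIt : Iᵀ = -I)
    (hI2 : I * I = -1) : ∃ c : ℝ, (B + c • I) * I = -(I * (B + c • I)) := by
  obtain ⟨c, hc⟩ := hsymm ((2 : ℝ)⁻¹ • (B * I + I * B))
    ((commutant J).smul_mem (add_mem (mul_mem hB hI) (mul_mem hI hB)) _)
    (by rw [Matrix.transpose_smul, Matrix.transpose_add, Matrix.transpose_mul,
          Matrix.transpose_mul, hBt, hIt, neg_mul_neg, neg_mul_neg, add_comm])
  refine ⟨c, ?_⟩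
  have h2 : B * I + I * B = (2 * c) • (1 : Matrix ι ι ℝ) := by
    rw [mul_smul, ← hc, smul_smul, mul_inv_cancel₀ two_ne_zero, one_smul]
  rw [eq_neg_iff_add_eq_zero, add_mul, mul_add, smul_mul_assoc, mul_smul_comm, hI2,
    add_add_add_comm, h2]
  module

theorem exists_complexStructure [Nonempty ι] (hskew : ∀ i, (J i)ᵀ = -J i)
    (hsymm : ∀ A ∈ commutant J, Aᵀ = A → ∃ c : ℝ, A = c • 1)
    (h : 1 < Module.finrank ℝ (commutant J)) :
    ∃ I ∈ commutant J, Iᵀ = -I ∧ I * I = -1 := by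
  obtain ⟨A, hA, hAn⟩ : ∃ A ∈ commutant J, A ∉ Submodule.span ℝ {(1 : Matrix ι ι ℝ)} := by
    by_contra! hcon
    have hle : Subalgebra.toSubmodule (commutant J) ≤ Submodule.span ℝ {1} := hcon
    have := (Submodule.finrank_mono hle).trans (finrank_span_le_card ({1} : Set (Matrix ι ι ℝ)))
    simp only [Set.toFinset_singleton, Finset.card_singleton] at this
    exact absurd (h.trans_le this) (lt_irrefl _)
  obtain ⟨c, B, hB, hBt, rfl⟩ := exists_eq_smul_one_add_skew hskew hsymm hA
  have hB0 : B ≠ 0 := by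
    rintro rfl
    exact hAn (by rw [add_zero]; exact Submodule.smul_mem _ _ (Submodule.mem_span_singleton_self _))
  obtain ⟨s, hs⟩ := exists_smul_sq_eq_neg_one hsymm hB hBt hB0
  exact ⟨s • B, (commutant J).smul_mem hB _, by rw [Matrix.transpose_smul, hBt, smul_neg], hs⟩

theorem exists_anticommuting_complexStructure [Nonempty ι] (hskew : ∀ i, (J i)ᵀ = -J i)
    (hsymm : ∀ A ∈ commutant J, Aᵀ = A → ∃ c : ℝ, A = c • 1)
    (h : 2 < Module.finrank ℝ (commutant J)) {I : Matrix ι ι ℝ} (hI : I ∈ commutant J)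
    (hIt : Iᵀ = -I) (hI2 : I * I = -1) :
    ∃ K ∈ commutant J, Kᵀ = -K ∧ K * K = -1 ∧ K * I = -(I * K) := by
  obtain ⟨A, hA, hAn⟩ : ∃ A ∈ commutant J, A ∉ Submodule.span ℝ {1, I} := by
    by_contra! hcon
    have hle : Subalgebra.toSubmodule (commutant J) ≤ Submodule.span ℝ {1, I} := hcon
    have h1 : Module.finrank ℝ (Submodule.span ℝ ({1, I} : Set (Matrix ι ι ℝ))) ≤ 2 := by
      classical
      have := finrank_span_finset_le_card (R := ℝ) ({1, I} : Finset (Matrix ι ι ℝ))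
      rw [Finset.coe_pair] at this
      exact this.trans Finset.card_le_two
    exact absurd (h.trans_le ((Submodule.finrank_mono hle).trans h1)) (lt_irrefl _)
  obtain ⟨c, B, hB, hBt, rfl⟩ := exists_eq_smul_one_add_skew hskew hsymm hA
  obtain ⟨a, ha⟩ := exists_add_smul_anticommute hsymm hB hBt hI hIt hI2
  have hC : B + a • I ∈ commutant J := add_mem hB ((commutant J).smul_mem hI _)
  have hCt : (B + a • I)ᵀ = -(B + a • I) := by
    rw [Matrix.transpose_add, Matrix.transpose_smul, hBt, hIt, smul_neg, neg_add]
  have hC0 : B + a • I ≠ 0 := by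
    intro h0
    refine hAn (Submodule.mem_span_pair.2 ⟨c, -a, ?_⟩)
    rw [eq_neg_of_add_eq_zero_left h0, neg_smul]
  obtain ⟨s, hs⟩ := exists_smul_sq_eq_neg_one hsymm hC hCt hC0
  exact ⟨s • (B + a • I), (commutant J).smul_mem hC _, by
    rw [Matrix.transpose_smul, hCt, smul_neg], hs, by
    rw [smul_mul_assoc, ha, smul_neg, mul_smul_comm]⟩

/-- A real `*`-algebra `A`, realized faithfully by matrices in such a way that the star becomes
the transpose and that the image is the commutant of the family `J`. -/
structure IsCommutantModel (A : Type*) [Ring A] [StarRing A] [Algebra ℝ A]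
    (J : κ → Matrix ι ι ℝ) (φ : A →ₐ[ℝ] Matrix ι ι ℝ) : Prop where
  injective : Function.Injective φ
  map_star (a : A) : φ (star a) = (φ a)ᵀ
  range_eq : φ.range = commutant J

theorem exists_model_real [Nonempty ι] (h : Module.finrank ℝ (commutant J) = 1) :
    ∃ φ : ℝ →ₐ[ℝ] Matrix ι ι ℝ, IsCommutantModel ℝ J φ := by
  refine ⟨Algebra.ofId ℝ _, RingHom.injective (Algebra.ofId ℝ (Matrix ι ι ℝ)).toRingHom,
    fun a => ?_, ?_⟩
  · simp [Algebra.ofId_apply, Algebra.algebraMap_eq_smul_one]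
  · rw [Subalgebra.eq_bot_of_finrank_one h]
    exact Algebra.range_ofId ..

theorem exists_model_complex [Nonempty ι] (hskew : ∀ i, (J i)ᵀ = -J i)
    (hsymm : ∀ A ∈ commutant J, Aᵀ = A → ∃ c : ℝ, A = c • 1)
    (h : Module.finrank ℝ (commutant J) = 2) :
    ∃ φ : ℂ →ₐ[ℝ] Matrix ι ι ℝ, IsCommutantModel ℂ J φ := by
  obtain ⟨I, hI, hIt, hI2⟩ := exists_complexStructure hskew hsymm (by omega)
  have hinj := RingHom.injective (Complex.liftAux I hI2).toRingHom
  refine ⟨Complex.liftAux I hI2, hinj, fun a => ?_, ?_⟩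
  · simp [Complex.liftAux_apply, Algebra.algebraMap_eq_smul_one, hIt]
  · have hle : (Complex.liftAux I hI2).range ≤ commutant J := by
      rintro _ ⟨z, rfl⟩
      exact add_mem ((commutant J).algebraMap_mem _) ((commutant J).smul_mem hI _)
    refine Subalgebra.toSubmodule_injective (Submodule.eq_of_le_of_finrank_eq hle ?_)
    have e1 : Module.finrank ℝ (Subalgebra.toSubmodule (commutant J)) = 2 := h
    have e2 : Module.finrank ℝ (Subalgebra.toSubmodule (Complex.liftAux I hI2).range) =
      Module.finrank ℝ ℂ := LinearMap.finrank_range_of_inj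
        (f := (Complex.liftAux I hI2).toLinearMap) hinj
    rw [e1, e2, Complex.finrank_real_complex]

theorem exists_model_quaternion [Nonempty ι] (hskew : ∀ i, (J i)ᵀ = -J i)
    (hsymm : ∀ A ∈ commutant J, Aᵀ = A → ∃ c : ℝ, A = c • 1)
    (h : 2 < Module.finrank ℝ (commutant J)) :
    ∃ φ : ℍ[ℝ] →ₐ[ℝ] Matrix ι ι ℝ, IsCommutantModel ℍ[ℝ] J φ := by
  obtain ⟨I, hI, hIt, hI2⟩ := exists_complexStructure hskew hsymm (by omega)
  obtain ⟨K, hK, hKt, hK2, hKI⟩ := exists_anticommuting_complexStructure hskew hsymm h hI hIt hI2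
  have hIK : K * I = -(I * K) := hKI
  let q : QuaternionAlgebra.Basis (Matrix ι ι ℝ) (-1 : ℝ) 0 (-1) :=
    { i := I
      j := K
      k := I * K
      i_mul_i := by simp [hI2]
      j_mul_j := by simp [hK2]
      i_mul_j := rfl
      j_mul_i := by simp [hIK] }
  obtain ⟨φ, hq⟩ : ∃ φ : ℍ[ℝ] →ₐ[ℝ] Matrix ι ι ℝ,
      ∀ x, φ x = x.re • 1 + x.imI • I + x.imJ • K + x.imK • (I * K) := by
    refine ⟨q.liftHom, fun x => ?_⟩
    rw [← Algebra.algebraMap_eq_smul_one]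
    rfl
  have hIKt : (I * K)ᵀ = -(I * K) := by
    rw [Matrix.transpose_mul, hIt, hKt, neg_mul_neg, hIK]
  refine ⟨φ, RingHom.injective φ.toRingHom, fun a => ?_, ?_⟩
  · rw [hq, hq]
    simp only [Matrix.transpose_add, Matrix.transpose_smul, Matrix.transpose_one, hIt, hKt, hIKt,
      Quaternion.re_star, Quaternion.imI_star, Quaternion.imJ_star, Quaternion.imK_star]
    module
  · refine le_antisymm ?_ fun A hA => ?_
    · rintro _ ⟨x, rfl⟩
      change φ x ∈ commutant J
      rw [hq]
      exact add_mem (add_mem (add_mem ((commutant J).smul_mem (one_mem _) _)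
        ((commutant J).smul_mem hI _)) ((commutant J).smul_mem hK _))
        ((commutant J).smul_mem (mul_mem hI hK) _)
    · obtain ⟨c, B, hB, hBt, rfl⟩ := exists_eq_smul_one_add_skew hskew hsymm hA
      obtain ⟨a, ha⟩ := exists_add_smul_anticommute hsymm hB hBt hI hIt hI2
      obtain ⟨b, hb⟩ := exists_add_smul_anticommute hsymm hB hBt hK hKt hK2
      -- `C` anticommutes with `I` and `K`, so it commutes with `I K`, and `C (I K)` is symmetric.
      set C := B + a • I + b • K with hCdef
      have hC : C ∈ commutant J :=
        add_mem (add_mem hB ((commutant J).smul_mem hI _)) ((commutant J).smul_mem hK _)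
      have hCt : Cᵀ = -C := by
        simp only [hCdef, Matrix.transpose_add, Matrix.transpose_smul, hBt, hIt, hKt]
        module
      have hCI : C * I = -(I * C) := by
        rw [hCdef, add_mul, ha, smul_mul_assoc, hIK, mul_add I (B + a • I), mul_smul_comm]
        module
      have hCK : C * K = -(K * C) := by
        rw [hCdef, add_right_comm, add_mul, hb, smul_mul_assoc, mul_add K (B + b • K),
          mul_smul_comm, hIK]
        module
      have hCIK : C * (I * K) = I * K * C := by
        rw [← mul_assoc, hCI, neg_mul, mul_assoc, hCK, mul_neg, neg_neg, mul_assoc]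
      obtain ⟨s, hs⟩ := hsymm (C * (I * K)) (mul_mem hC (mul_mem hI hK)) (by
        rw [Matrix.transpose_mul, hIKt, hCt, neg_mul_neg, hCIK])
      have hIK2 : I * K * (I * K) = -1 := by
        calc I * K * (I * K) = I * (K * I) * K := by noncomm_ring
          _ = -(I * I * (K * K)) := by rw [hIK]; noncomm_ring
          _ = -1 := by rw [hI2, hK2, neg_mul_neg, one_mul]
      have hCs : C = -(s • (I * K)) := by
        have := congrArg (· * (I * K)) hs
        simp only [mul_assoc C, hIK2, mul_neg, mul_one, smul_mul_assoc, one_mul] at this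
        rw [← this, neg_neg]
      refine ⟨⟨c, -a, -b, -s⟩, (hq _).trans ?_⟩
      change c • 1 + (-a) • I + (-b) • K + (-s) • (I * K) = _
      have hBC : B = C - a • I - b • K := by rw [hCdef]; module
      rw [hBC, hCs]
      module

end StarAlgebra

/-! ### Orthonormal intertwiners -/

section Intertwiners

variable {ν ι κ : Type*} [Fintype ν] [Fintype ι]
  {K : κ → Matrix ν ν ℝ} {J : κ → Matrix ι ι ℝ}

theorem transpose_mul_intertwines (hK : ∀ i, (K i)ᵀ = -K i) (hJ : ∀ i, (J i)ᵀ = -J i)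
    {T : Matrix ν ι ℝ} (hT : ∀ i, K i * T = T * J i) (i : κ) : J i * Tᵀ = Tᵀ * K i := by
  have := congrArg Matrix.transpose (hT i)
  rw [Matrix.transpose_mul, Matrix.transpose_mul, hK, hJ, Matrix.mul_neg, Matrix.neg_mul,
    neg_inj] at this
  exact this.symm

variable [DecidableEq ι]

theorem transpose_mul_mem_commutant (hK : ∀ i, (K i)ᵀ = -K i) (hJ : ∀ i, (J i)ᵀ = -J i)
    {T S : Matrix ν ι ℝ} (hT : ∀ i, K i * T = T * J i) (hS : ∀ i, K i * S = S * J i) :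
    Tᵀ * S ∈ commutant J := by
  rw [mem_commutant]
  intro i
  rw [← Matrix.mul_assoc, transpose_mul_intertwines hK hJ hT, Matrix.mul_assoc, hS,
    ← Matrix.mul_assoc]

/-- Gram–Schmidt for intertwiners: since `Sᵀ S` is a scalar for every intertwiner `S`, a nonzero
intertwiner can be normalized to an isometric one. -/
theorem exists_orthonormal_intertwiners [DecidableEq ν] [Nonempty ι] {m : ℕ}
    (hcard : Fintype.card ν = Fintype.card ι * m)
    (hK : ∀ i, (K i)ᵀ = -K i) (hJ : ∀ i, (J i)ᵀ = -J i)
    (hsymm : ∀ A ∈ commutant J, Aᵀ = A → ∃ c : ℝ, A = c • 1)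
    {S : Fin m → Matrix ν ι ℝ} (hS : ∀ a i, K i * S a = S a * J i)
    (hspan : ∀ y : ν → ℝ, (∀ a, y ᵥ* S a = 0) → y = 0) :
    ∀ k ≤ m, ∃ T : Fin k → Matrix ν ι ℝ, (∀ a i, K i * T a = T a * J i) ∧
      ∀ a b, (T a)ᵀ * T b = if a = b then 1 else 0 := by
  intro k
  induction k with
  | zero => exact fun _ => ⟨fun _ => 0, fun a => a.elim0, fun a => a.elim0⟩
  | succ k ih =>
    intro hk
    obtain ⟨T, hT, hTT⟩ := ih (by omega)
    -- The sum of the projections onto the images of the `T a` has trace less than `card ν`.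
    set Q : Matrix ν ν ℝ := ∑ b, T b * (T b)ᵀ with hQ
    have hQK : ∀ i, K i * Q = Q * K i := fun i => by
      rw [hQ, Finset.mul_sum, Finset.sum_mul]
      refine Finset.sum_congr rfl fun b _ => ?_
      rw [← Matrix.mul_assoc, hT, Matrix.mul_assoc, transpose_mul_intertwines hK hJ (hT b),
        Matrix.mul_assoc]
    have hTQ : ∀ a, (T a)ᵀ * Q = (T a)ᵀ := fun a => by
      rw [hQ, Matrix.mul_sum, Finset.sum_eq_single a]
      · rw [← Matrix.mul_assoc, hTT, if_pos rfl, Matrix.one_mul]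
      · intro b _ hba
        rw [← Matrix.mul_assoc, hTT, if_neg hba.symm, Matrix.zero_mul]
      · simp
    have htr : Q.trace = Fintype.card ι * k := by
      rw [hQ, Matrix.trace_sum]
      simp_rw [Matrix.trace_mul_comm (T _), hTT]
      simp [mul_comm]
    obtain ⟨a, ha⟩ : ∃ a, (1 - Q) * S a ≠ 0 := by
      by_contra! hcon
      have hQ1 : 1 - Q = 0 := by
        refine funext fun x => hspan _ fun a => by
          rw [← Matrix.mul_apply_eq_vecMul, hcon]
          rfl
      rw [← sub_eq_zero.1 hQ1, Matrix.trace_one, hcard, Nat.cast_mul] at htr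
      have hpos : (0 : ℝ) < Fintype.card ι := Nat.cast_pos.2 Fintype.card_pos
      have := mul_left_cancel₀ hpos.ne' htr
      have : m = k := by exact_mod_cast this
      omega
    set R := (1 - Q) * S a with hR
    have hRK : ∀ i, K i * R = R * J i := fun i => by
      have h1 : K i * (1 - Q) = (1 - Q) * K i := by
        rw [Matrix.mul_sub, Matrix.sub_mul, hQK, Matrix.mul_one, Matrix.one_mul]
      rw [hR, ← Matrix.mul_assoc, h1, Matrix.mul_assoc, hS, ← Matrix.mul_assoc]
    have hTR : ∀ b, (T b)ᵀ * R = 0 := fun b => by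
      rw [hR, ← Matrix.mul_assoc, Matrix.mul_sub, hTQ, Matrix.mul_one, sub_self, Matrix.zero_mul]
    have hRT : ∀ b, Rᵀ * T b = 0 := fun b => by
      rw [← Matrix.transpose_transpose (T b), ← Matrix.transpose_mul, hTR, Matrix.transpose_zero]
    obtain ⟨s, hs⟩ := hsymm _ (transpose_mul_mem_commutant hK hJ hRK hRK)
      (by rw [Matrix.transpose_mul, Matrix.transpose_transpose])
    have hpos := pos_of_transpose_mul_self ha hs
    refine ⟨Fin.cons ((√s)⁻¹ • R) T, fun b => ?_, fun b c => ?_⟩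
    · refine Fin.cases ?_ (fun b => ?_) b
      · intro i
        rw [Fin.cons_zero, Matrix.mul_smul, hRK, Matrix.smul_mul]
      · simpa using hT b
    · refine Fin.cases ?_ (fun b => ?_) b <;> refine Fin.cases ?_ (fun c => ?_) c
      · rw [Fin.cons_zero, if_pos rfl, Matrix.transpose_smul, Matrix.smul_mul, Matrix.mul_smul, hs,
          smul_smul, smul_smul, ← mul_inv, Real.mul_self_sqrt hpos.le, inv_mul_cancel₀ hpos.ne',
          one_smul]
      · rw [Fin.cons_zero, Fin.cons_succ, if_neg (Fin.succ_ne_zero c).symm, Matrix.transpose_smul,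
          Matrix.smul_mul, hRT, smul_zero]
      · rw [Fin.cons_zero, Fin.cons_succ, if_neg (Fin.succ_ne_zero b), Matrix.mul_smul, hTR,
          smul_zero]
      · simp [hTT]

end Intertwiners

/-! ### The centralizer as a Lie algebra of skew-Hermitian matrices -/

section Isomorphism

variable {ν ι κ : Type*}
  {K : κ → Matrix ν ν ℝ} {J : κ → Matrix ι ι ℝ}

/-- The matrices `T a`, for `a : Fin m`, placed side by side. -/
def sideBySide {m : ℕ} (T : Fin m → Matrix ν ι ℝ) : Matrix ν (Fin m × ι) ℝ :=
  Matrix.of fun x p => T p.1 x p.2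

variable {m : ℕ} {T : Fin m → Matrix ν ι ℝ}

theorem mul_sideBySide [Fintype ν] [Fintype ι] (hT : ∀ a i, K i * T a = T a * J i) (i : κ) :
    K i * sideBySide T =
      sideBySide T * Matrix.comp _ _ _ _ ℝ (Matrix.diagonal fun _ : Fin m => J i) := by
  ext x ⟨a, y⟩
  have := congrFun (congrFun (hT a i) x) y
  rw [Matrix.mul_apply, Matrix.mul_apply] at this
  rw [Matrix.mul_apply, Matrix.mul_apply, Fintype.sum_prod_type, Finset.sum_eq_single a]
  · simpa [sideBySide, Matrix.comp_apply] using this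
  · intro b _ hb
    simp [Matrix.comp_apply, Matrix.diagonal_apply_ne _ hb]
  · simp

theorem sideBySide_transpose_mul_self [Fintype ν] [DecidableEq ι]
    (hTT : ∀ a b, (T a)ᵀ * T b = if a = b then 1 else 0) :
    (sideBySide T)ᵀ * sideBySide T = 1 := by
  ext ⟨a, x⟩ ⟨b, y⟩
  have := congrFun (congrFun (hTT a b) x) y
  rw [Matrix.mul_apply] at this ⊢
  refine Eq.trans this ?_
  by_cases hab : a = b <;> simp [hab, Matrix.one_apply]

variable [Fintype ι] [DecidableEq ι]

theorem sideBySide_mul_self_transpose [Fintype ν] [DecidableEq ν]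
    (hcard : Fintype.card ν = Fintype.card ι * m)
    (hTT : ∀ a b, (T a)ᵀ * T b = if a = b then 1 else 0) :
    sideBySide T * (sideBySide T)ᵀ = 1 :=
  (Matrix.mul_eq_one_comm_of_card_eq _ _ _ (by simp [hcard, mul_comm])).1
    (sideBySide_transpose_mul_self hTT)

/-- The block matrix with entries in `A`, realized by real matrices through `φ` and transported
by the matrix formed from the `T a`. -/
noncomputable def blockHom {A : Type*} [Ring A] [Algebra ℝ A] (φ : A →ₐ[ℝ] Matrix ι ι ℝ)
    (T : Fin m → Matrix ν ι ℝ) : Matrix (Fin m) (Fin m) A →ₗ[ℝ] Matrix ν ν ℝ where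
  toFun Y := sideBySide T * Matrix.comp _ _ _ _ ℝ (Y.map φ) * (sideBySide T)ᵀ
  map_add' X Y := by
    rw [← Matrix.add_mul, ← Matrix.mul_add]
    congr 2
    ext
    simp [Matrix.comp_apply]
  map_smul' c X := by
    rw [RingHom.id_apply, ← Matrix.smul_mul, ← Matrix.mul_smul]
    congr 2
    ext
    simp [Matrix.comp_apply]

theorem blockHom_apply {A : Type*} [Ring A] [Algebra ℝ A] (φ : A →ₐ[ℝ] Matrix ι ι ℝ)
    (Y : Matrix (Fin m) (Fin m) A) :
    blockHom φ T Y = sideBySide T * Matrix.comp _ _ _ _ ℝ (Y.map φ) * (sideBySide T)ᵀ := rfl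

theorem blockHom_conjTranspose {A : Type*} [Ring A] [StarRing A] [Algebra ℝ A]
    {φ : A →ₐ[ℝ] Matrix ι ι ℝ} (hφ : ∀ a, φ (star a) = (φ a)ᵀ) (Y : Matrix (Fin m) (Fin m) A) :
    blockHom φ T Yᴴ = (blockHom φ T Y)ᵀ := by
  have h : Matrix.comp _ _ _ _ ℝ (Yᴴ.map φ) = (Matrix.comp _ _ _ _ ℝ (Y.map φ))ᵀ := by
    ext ⟨a, x⟩ ⟨b, y⟩
    simp [Matrix.comp_apply, hφ]
  rw [blockHom_apply, blockHom_apply, h, Matrix.transpose_mul, Matrix.transpose_mul,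
    Matrix.transpose_transpose, Matrix.mul_assoc]

variable [Fintype ν]

theorem blockHom_mul {A : Type*} [Ring A] [Algebra ℝ A] (φ : A →ₐ[ℝ] Matrix ι ι ℝ)
    (hT : (sideBySide T)ᵀ * sideBySide T = 1) (X Y : Matrix (Fin m) (Fin m) A) :
    blockHom φ T (X * Y) = blockHom φ T X * blockHom φ T Y := by
  have h : Matrix.comp _ _ _ _ ℝ ((X * Y).map φ) =
      Matrix.comp _ _ _ _ ℝ (X.map φ) * Matrix.comp _ _ _ _ ℝ (Y.map φ) := by
    rw [Matrix.map_mul]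
    exact map_mul (Matrix.compRingEquiv (Fin m) ι ℝ) _ _
  simp only [blockHom_apply, h, Matrix.mul_assoc]
  rw [← Matrix.mul_assoc (sideBySide T)ᵀ (sideBySide T), hT, Matrix.one_mul]

theorem transpose_mul_blockHom_mul {A : Type*} [Ring A] [Algebra ℝ A] (φ : A →ₐ[ℝ] Matrix ι ι ℝ)
    (hT : (sideBySide T)ᵀ * sideBySide T = 1) (Y : Matrix (Fin m) (Fin m) A) :
    (sideBySide T)ᵀ * blockHom φ T Y * sideBySide T = Matrix.comp _ _ _ _ ℝ (Y.map φ) := by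
  rw [blockHom_apply]
  simp only [Matrix.mul_assoc, hT, Matrix.mul_one]
  rw [← Matrix.mul_assoc, hT, Matrix.one_mul]

theorem blockHom_injective {A : Type*} [Ring A] [Algebra ℝ A] {φ : A →ₐ[ℝ] Matrix ι ι ℝ}
    (hφ : Function.Injective φ) (hT : (sideBySide T)ᵀ * sideBySide T = 1) :
    Function.Injective (blockHom φ T) := fun X Y h => by
  have h' : X.map φ = Y.map φ := by
    apply (Matrix.comp _ _ _ _ ℝ).injective
    rw [← transpose_mul_blockHom_mul φ hT, h, transpose_mul_blockHom_mul φ hT]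
  exact Matrix.map_injective hφ h'

theorem range_blockHom [DecidableEq ν] {A : Type*} [Ring A] [StarRing A] [Algebra ℝ A]
    {φ : A →ₐ[ℝ] Matrix ι ι ℝ} (hφ : IsCommutantModel A J φ)
    (hT : ∀ a i, K i * T a = T a * J i) (hT1 : (sideBySide T)ᵀ * sideBySide T = 1)
    (hT2 : sideBySide T * (sideBySide T)ᵀ = 1) (X : Matrix ν ν ℝ) :
    X ∈ LinearMap.range (blockHom φ T) ↔ X ∈ commutant K := by
  set U := sideBySide T
  set D : κ → Matrix (Fin m × ι) (Fin m × ι) ℝ := fun i =>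
    Matrix.comp _ _ _ _ ℝ (Matrix.diagonal fun _ : Fin m => J i)
  have hU : ∀ i, K i * U = U * D i := mul_sideBySide hT
  have hKD : ∀ i, K i = U * D i * Uᵀ := fun i => by
    rw [← hU, Matrix.mul_assoc, hT2, Matrix.mul_one]
  have hconj : ∀ i (Z : Matrix (Fin m) (Fin m) (Matrix ι ι ℝ)),
      D i * Matrix.comp _ _ _ _ ℝ Z = Matrix.comp _ _ _ _ ℝ Z * D i ↔
        ∀ a b, J i * Z a b = Z a b * J i := by
    intro i Z
    have e1 : D i * Matrix.comp _ _ _ _ ℝ Z =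
      Matrix.comp _ _ _ _ ℝ ((Matrix.diagonal fun _ : Fin m => J i) * Z) :=
        (map_mul (Matrix.compRingEquiv (Fin m) ι ℝ) _ _).symm
    have e2 : Matrix.comp _ _ _ _ ℝ Z * D i =
      Matrix.comp _ _ _ _ ℝ (Z * (Matrix.diagonal fun _ : Fin m => J i)) :=
        (map_mul (Matrix.compRingEquiv (Fin m) ι ℝ) _ _).symm
    rw [e1, e2, (Matrix.comp _ _ _ _ ℝ).injective.eq_iff]
    simp_rw [← Matrix.ext_iff (M := _ * Z), Matrix.diagonal_mul, Matrix.mul_diagonal]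
  have hcomm : ∀ W : Matrix (Fin m × ι) (Fin m × ι) ℝ, U * W * Uᵀ ∈ commutant K ↔
      ∀ i, D i * W = W * D i := by
    intro W
    have h1 : ∀ i, K i * (U * W * Uᵀ) = U * (D i * W) * Uᵀ := fun i => by
      rw [← Matrix.mul_assoc, ← Matrix.mul_assoc, hU]
      simp only [Matrix.mul_assoc]
    have h2 : ∀ i, U * W * Uᵀ * K i = U * (W * D i) * Uᵀ := fun i => by
      rw [hKD]
      simp only [Matrix.mul_assoc]
      rw [← Matrix.mul_assoc Uᵀ U, hT1, Matrix.one_mul]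
    rw [mem_commutant]
    refine forall_congr' fun i => ?_
    rw [h1, h2]
    refine ⟨fun h => ?_, fun h => by rw [h]⟩
    have := congrArg (fun M => Uᵀ * M * U) h
    simp only [Matrix.mul_assoc, hT1, Matrix.mul_one] at this
    rwa [← Matrix.mul_assoc, hT1, Matrix.one_mul, ← Matrix.mul_assoc Uᵀ, hT1,
      Matrix.one_mul] at this
  constructor
  · rintro ⟨Y, rfl⟩
    rw [blockHom_apply, hcomm]
    intro i
    rw [hconj]
    intro a b
    have : φ (Y a b) ∈ commutant J := hφ.range_eq ▸ ⟨Y a b, rfl⟩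
    exact mem_commutant.1 this i
  · intro hX
    set Z := (Matrix.comp (Fin m) (Fin m) ι ι ℝ).symm (Uᵀ * X * U)
    have hZ : Matrix.comp _ _ _ _ ℝ Z = Uᵀ * X * U := Equiv.apply_symm_apply _ _
    have hXU : U * (Uᵀ * X * U) * Uᵀ = X := by
      rw [← Matrix.mul_assoc, ← Matrix.mul_assoc, hT2, Matrix.one_mul, Matrix.mul_assoc, hT2,
        Matrix.mul_one]
    have hmem : ∀ a b, Z a b ∈ φ.range := fun a b => by
      rw [hφ.range_eq, mem_commutant]
      intro i
      refine (hconj i Z).1 ?_ a b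
      rw [hZ]
      exact (hcomm _).1 (by rwa [hXU]) i
    choose Y hY using hmem
    refine ⟨Matrix.of Y, ?_⟩
    have : (Matrix.of Y).map φ = Z := by
      ext1 a b
      exact hY a b
    rw [blockHom_apply, this, hZ, hXU]

/-- A centralizer consisting of the skew matrices that commute with the `K i` is isomorphic to the
skew-Hermitian matrices over the star algebra that models the commutant of the `J i`. -/
theorem nonempty_lieEquiv_skewHermitian [DecidableEq ν] {A : Type*} [Ring A] [StarRing A]
    [Algebra ℝ A] [StarModule ℝ A] {φ : A →ₐ[ℝ] Matrix ι ι ℝ} (hφ : IsCommutantModel A J φ)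
    (hcard : Fintype.card ν = Fintype.card ι * m)
    (hT : ∀ a i, K i * T a = T a * J i) (hTT : ∀ a b, (T a)ᵀ * T b = if a = b then 1 else 0)
    (L : LieSubalgebra ℝ (Matrix ν ν ℝ)) (hL : ∀ X, X ∈ L ↔ Xᵀ = -X ∧ X ∈ commutant K) :
    Nonempty (L ≃ₗ⁅ℝ⁆ skewHermitian m A) := by
  have hT1 := sideBySide_transpose_mul_self hTT
  have hT2 := sideBySide_mul_self_transpose hcard hTT
  have hinj := blockHom_injective hφ.injective hT1
  have hskew : ∀ Y : Matrix (Fin m) (Fin m) A, (blockHom φ T Y)ᵀ = -blockHom φ T Y ↔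
      Y ∈ skewHermitian m A := fun Y => by
    rw [← blockHom_conjTranspose hφ.map_star, ← map_neg, hinj.eq_iff]
    rfl
  let f : skewHermitian m A →ₗ⁅ℝ⁆ L :=
    { toFun Y := ⟨blockHom φ T Y, (hL _).2 ⟨(hskew _).2 Y.2,
        (range_blockHom hφ hT hT1 hT2 _).1 ⟨Y, rfl⟩⟩⟩
      map_add' X Y := Subtype.ext (map_add (blockHom φ T) _ _)
      map_smul' c X := Subtype.ext (map_smul (blockHom φ T) _ _)
      map_lie' {X Y} := Subtype.ext <| by
        change blockHom φ T (X.1 * Y.1 - Y.1 * X.1) =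
          blockHom φ T X * blockHom φ T Y - blockHom φ T Y * blockHom φ T X
        rw [map_sub, blockHom_mul φ hT1, blockHom_mul φ hT1] }
  refine ⟨(LieEquiv.ofBijective f ⟨fun X Y h => ?_, fun X => ?_⟩).symm⟩
  · exact Subtype.ext (hinj (congrArg Subtype.val h))
  · obtain ⟨h1, h2⟩ := (hL _).1 X.2
    obtain ⟨Y, hY⟩ := (range_blockHom hφ hT hT1 hT2 _).2 h2
    exact ⟨⟨Y, (hskew Y).1 (by rw [hY]; exact h1)⟩, Subtype.ext hY⟩

end Isomorphism

/-! ### Generators of the even Clifford algebra -/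

section Generators

theorem bivec_self {r : ℕ} (i : Fin r) : bivec i i = -1 := by
  have h := (CliffordAlgebra.even.ι (negSumSq r)).contract (Pi.single i 1)
  rw [negSumSq_single, map_neg, map_one] at h
  exact h

theorem eq_top_of_bivec_mem {r : ℕ} (S : Subalgebra ℝ (EvenCl r)) (hS : ∀ i j, bivec i j ∈ S) :
    S = ⊤ := by
  have hbilin : ∀ v w, (CliffordAlgebra.even.ι (negSumSq r)).bilin v w ∈ S := by
    intro v w
    rw [← Finset.univ_sum_single v, ← Finset.univ_sum_single w]
    simp only [map_sum, LinearMap.sum_apply]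
    refine sum_mem fun i _ => sum_mem fun j _ => ?_
    have hs : ∀ (k : Fin r) (c : ℝ), (Pi.single k c : Fin r → ℝ) = c • Pi.single k 1 :=
      fun k c => by rw [← Pi.single_smul, smul_eq_mul, mul_one]
    rw [hs i, hs j, map_smul, map_smul, LinearMap.smul_apply]
    exact S.smul_mem (S.smul_mem (hS _ _) _) _
  refine eq_top_iff.2 ?_
  rintro ⟨x, hx⟩ -
  refine CliffordAlgebra.even_induction (negSumSq r)
    (motive := fun x hx => (⟨x, hx⟩ : EvenCl r) ∈ S) ?_ ?_ ?_ x hx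
  · exact fun c => S.algebraMap_mem c
  · exact fun x y hx hy h1 h2 => S.add_mem h1 h2
  · exact fun v w x hx h => S.mul_mem (hbilin v w) h

/-- The elements `e₀ eᵢ` generate the even Clifford algebra. -/
theorem commute_of_commute_bivec_zero {n : ℕ} {B : Type*} [Ring B] [Algebra ℝ B]
    (f : EvenCl (n + 1) →ₐ[ℝ] B) {b : B} (h : ∀ i : Fin n, f (bivec 0 i.succ) * b =
      b * f (bivec 0 i.succ)) (x : EvenCl (n + 1)) : f x * b = b * f x := by
  have hS : (Subalgebra.centralizer ℝ {b}).comap f = ⊤ := by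
    refine eq_top_of_bivec_mem _ fun i j => ?_
    have h0 : ∀ i : Fin (n + 1), bivec 0 i ∈ (Subalgebra.centralizer ℝ {b}).comap f := by
      intro i
      refine Fin.cases ?_ (fun i => ?_) i
      · rw [bivec_self]
        exact neg_mem (one_mem _)
      · rw [Subalgebra.mem_comap, Subalgebra.mem_centralizer_iff]
        rintro _ rfl
        exact (h i).symm
    by_cases hi : i = 0
    · exact hi ▸ h0 j
    · rw [← neg_neg (bivec i j), ← bivec_mul i 0 j, bivec_swap (Ne.symm hi)]
      exact neg_mem (mul_mem (neg_mem (h0 i)) (h0 j))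
  have hx : x ∈ (Subalgebra.centralizer ℝ {b}).comap f := hS ▸ Algebra.mem_top
  rw [Subalgebra.mem_comap, Subalgebra.mem_centralizer_iff] at hx
  exact (hx b rfl).symm

theorem bivec_zero_succ_sq {n : ℕ} (i : Fin n) :
    bivec (0 : Fin (n + 1)) i.succ * bivec 0 i.succ = -1 := by
  rw [← bivec_self i.succ, ← neg_neg (bivec i.succ i.succ), ← bivec_mul i.succ 0 i.succ,
    bivec_swap (Fin.succ_ne_zero i).symm, neg_mul, neg_neg]

theorem bivec_zero_succ_anticomm {n : ℕ} {i j : Fin n} (h : i ≠ j) :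
    bivec (0 : Fin (n + 1)) i.succ * bivec 0 j.succ = -(bivec 0 j.succ * bivec 0 i.succ) := by
  have key : ∀ i j : Fin n, bivec (0 : Fin (n + 1)) i.succ * bivec 0 j.succ =
      bivec i.succ j.succ := fun i j => by
    rw [← neg_neg (bivec i.succ j.succ), ← bivec_mul i.succ 0 j.succ,
      bivec_swap (Fin.succ_ne_zero i).symm, neg_mul, neg_neg]
  rw [key, key, bivec_swap fun e => h (Fin.succ_injective _ e).symm]

theorem mem_centralizerIn_spinHat {n m N : ℕ} {Δ : Type*} [AddCommGroup Δ] [Module ℝ Δ]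
    [Module (EvenCl (n + 1)) Δ] [IsScalarTower ℝ (EvenCl (n + 1)) Δ]
    (ψ : (Δ ⊗[ℝ] (Fin m → ℝ)) ≃ₗ[ℝ] (Fin N → ℝ)) (X : Matrix (Fin N) (Fin N) ℝ) :
    X ∈ centralizerIn (LieAlgebra.Orthogonal.so (Fin N) ℝ) (spinHat (r := n + 1) ψ) ↔
      Xᵀ = -X ∧ X ∈ commutant fun i : Fin n => diagRep (r := n + 1) ψ (bivec 0 i.succ) := by
  rw [← LieAlgebra.Orthogonal.mem_so, mem_commutant]
  refine and_congr_right fun _ => ⟨fun h i => ?_, fun h => ?_⟩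
  · have := h (diagRep ψ (bivec 0 i.succ))
      ⟨bivec 0 i.succ, bivec_mem (Fin.succ_ne_zero i).symm, rfl⟩
    exact (sub_eq_zero.1 this).symm
  · rintro _ ⟨x, -, rfl⟩
    exact sub_eq_zero.2 (commute_of_commute_bivec_zero (diagRep ψ) h x).symm

end Generators

/-! ### Reduction to matrices -/

section Reduction

/-- The inclusion of `Δ` into `ℝ^N` as the `a`-th summand of `Δ ⊗ ℝ^m`. -/
noncomputable def summand {m N : ℕ} {Δ : Type*} [AddCommGroup Δ] [Module ℝ Δ]
    (ψ : (Δ ⊗[ℝ] (Fin m → ℝ)) ≃ₗ[ℝ] (Fin N → ℝ)) (a : Fin m) : Δ →ₗ[ℝ] (Fin N → ℝ) :=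
  ψ.toLinearMap ∘ₗ (TensorProduct.mk ℝ Δ (Fin m → ℝ)).flip (Pi.single a 1)

theorem summand_apply {m N : ℕ} {Δ : Type*} [AddCommGroup Δ] [Module ℝ Δ]
    (ψ : (Δ ⊗[ℝ] (Fin m → ℝ)) ≃ₗ[ℝ] (Fin N → ℝ)) (a : Fin m) (v : Δ) :
    summand ψ a v = ψ (v ⊗ₜ Pi.single a 1) := rfl

theorem summand_injective {m N : ℕ} {Δ : Type*} [AddCommGroup Δ] [Module ℝ Δ]
    (ψ : (Δ ⊗[ℝ] (Fin m → ℝ)) ≃ₗ[ℝ] (Fin N → ℝ)) (a : Fin m) :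
    Function.Injective (summand ψ a) := by
  intro v w h
  have h1 := ψ.injective h
  have := congrArg (fun t => TensorProduct.rid ℝ Δ ((LinearMap.proj a).lTensor Δ t)) h1
  simpa using this

theorem dotProduct_eq_zero_of_summand {m N : ℕ} {Δ : Type*} [AddCommGroup Δ] [Module ℝ Δ]
    (ψ : (Δ ⊗[ℝ] (Fin m → ℝ)) ≃ₗ[ℝ] (Fin N → ℝ)) {y : Fin N → ℝ}
    (h : ∀ a v, y ⬝ᵥ summand ψ a v = 0) : y = 0 := by
  have key : ∀ t, y ⬝ᵥ ψ t = 0 := by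
    intro t
    induction t with
    | zero => simp
    | add s t hs ht => rw [map_add, dotProduct_add, hs, ht, add_zero]
    | tmul v w =>
      rw [← Finset.univ_sum_single w, TensorProduct.tmul_sum, map_sum, dotProduct_sum]
      refine Finset.sum_eq_zero fun a _ => ?_
      have : (Pi.single a (w a) : Fin m → ℝ) = w a • Pi.single a 1 := by
        rw [← Pi.single_smul, smul_eq_mul, mul_one]
      rw [this, TensorProduct.tmul_smul, map_smul, dotProduct_smul, ← summand_apply, h, smul_zero]
  have := key (ψ.symm y)
  rwa [LinearEquiv.apply_symm_apply, dotProduct_self_eq_zero] at this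

theorem exists_basis_orthonormal_summand {m N : ℕ} {Δ : Type*} [AddCommGroup Δ] [Module ℝ Δ]
    (ψ : (Δ ⊗[ℝ] (Fin m → ℝ)) ≃ₗ[ℝ] (Fin N → ℝ)) (a : Fin m) :
    ∃ b : Module.Basis (Fin (Module.finrank ℝ Δ)) ℝ Δ,
      ∀ i j, summand ψ a (b i) ⬝ᵥ summand ψ a (b j) = if i = j then 1 else 0 := by
  let f : Δ →ₗ[ℝ] EuclideanSpace ℝ (Fin N) :=
    (WithLp.linearEquiv 2 ℝ (Fin N → ℝ)).symm.toLinearMap ∘ₗ summand ψ a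
  have hf : Function.Injective f :=
    (WithLp.linearEquiv 2 ℝ (Fin N → ℝ)).symm.injective.comp (summand_injective ψ a)
  let e : Δ ≃ₗ[ℝ] LinearMap.range f := LinearEquiv.ofInjective f hf
  let c := (stdOrthonormalBasis ℝ (LinearMap.range f)).reindex (finCongr e.finrank_eq.symm)
  refine ⟨c.toBasis.map e.symm, fun i j => ?_⟩
  have h := orthonormal_iff_ite.1 c.orthonormal i j
  have he : ∀ i, f ((c.toBasis.map e.symm) i) = c i := fun i => by
    rw [Module.Basis.map_apply, OrthonormalBasis.coe_toBasis]
    exact congrArg Subtype.val (e.apply_symm_apply (c i))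
  rw [Submodule.coe_inner, ← he, ← he, EuclideanSpace.inner_eq_star_dotProduct] at h
  rw [← h, star_trivial, dotProduct_comm]
  rfl

variable {n m N : ℕ} {Δ : Type*} [AddCommGroup Δ] [Module ℝ Δ] [Module (EvenCl n) Δ]
  [IsScalarTower ℝ (EvenCl n) Δ]

/-- The representation of `Cl_n^0` on `Δ` in matrix form. -/
noncomputable def matrixRep {d : ℕ} (b : Module.Basis (Fin d) ℝ Δ) :
    EvenCl n →ₐ[ℝ] Matrix (Fin d) (Fin d) ℝ :=
  (LinearMap.toMatrixAlgEquiv b).toAlgHom.comp (Algebra.lsmul ℝ ℝ Δ)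

theorem diagRep_mul_summand {d : ℕ} (b : Module.Basis (Fin d) ℝ Δ)
    (ψ : (Δ ⊗[ℝ] (Fin m → ℝ)) ≃ₗ[ℝ] (Fin N → ℝ)) (a : Fin m) (x : EvenCl n) :
    diagRep ψ x * LinearMap.toMatrix b (Pi.basisFun ℝ (Fin N)) (summand ψ a) =
      LinearMap.toMatrix b (Pi.basisFun ℝ (Fin N)) (summand ψ a) * matrixRep b x := by
  have h1 : diagRep ψ x = LinearMap.toMatrix (Pi.basisFun ℝ (Fin N)) (Pi.basisFun ℝ (Fin N))
      (ψ.conj ((Algebra.lsmul ℝ ℝ Δ x).rTensor (Fin m → ℝ))) := by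
    rw [LinearMap.toMatrix_eq_toMatrix']
    rfl
  have h2 : matrixRep b x = LinearMap.toMatrix b b (Algebra.lsmul ℝ ℝ Δ x) := rfl
  rw [h1, h2, ← LinearMap.toMatrix_comp, ← LinearMap.toMatrix_comp]
  congr 1
  ext1 v
  simp [summand_apply, LinearEquiv.conj_apply]

/-- Schur's lemma: a symmetric matrix has a real eigenvalue, and the eigenspace is a submodule. -/
theorem exists_eq_smul_one_of_symmetric {n : ℕ} {Δ : Type*} [AddCommGroup Δ] [Module ℝ Δ]
    [Module (EvenCl (n + 1)) Δ] [IsScalarTower ℝ (EvenCl (n + 1)) Δ]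
    [IsSimpleModule (EvenCl (n + 1)) Δ] {d : ℕ} [NeZero d] (b : Module.Basis (Fin d) ℝ Δ)
    {A : Matrix (Fin d) (Fin d) ℝ}
    (hA : A ∈ commutant fun i : Fin n => matrixRep b (bivec 0 i.succ)) (hAt : Aᵀ = A) :
    ∃ c : ℝ, A = c • 1 := by
  have hAh : A.IsHermitian := by
    rwa [Matrix.IsHermitian, Matrix.conjTranspose_eq_transpose_of_trivial]
  set c := hAh.eigenvalues 0
  set v := hAh.eigenvectorBasis 0
  have hv : A *ᵥ v = c • v := hAh.mulVec_eigenvectorBasis 0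
  have hv0 : v ≠ 0 := hAh.eigenvectorBasis.orthonormal.ne_zero 0
  set B := A - c • (1 : Matrix (Fin d) (Fin d) ℝ) with hB
  have hBc : B ∈ commutant fun i : Fin n => matrixRep b (bivec 0 i.succ) :=
    sub_mem hA (Subalgebra.smul_mem _ (one_mem _) c)
  have hcomm : ∀ x : EvenCl (n + 1), matrixRep b x * B = B * matrixRep b x :=
    commute_of_commute_bivec_zero (matrixRep b) (mem_commutant.1 hBc)
  set g : Δ →ₗ[ℝ] Δ := Matrix.toLinAlgEquiv b B with hg
  have hgx : ∀ (x : EvenCl (n + 1)) (w : Δ), g (x • w) = x • g w := by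
    intro x w
    have := congrArg (Matrix.toLinAlgEquiv b) (hcomm x)
    rw [map_mul, map_mul] at this
    have h1 : Matrix.toLinAlgEquiv b (matrixRep b x) = Algebra.lsmul ℝ ℝ Δ x :=
      Matrix.toLinAlgEquiv_toMatrixAlgEquiv b _
    rw [h1] at this
    exact (LinearMap.congr_fun this w).symm
  let g' : Δ →ₗ[EvenCl (n + 1)] Δ :=
    { toFun := g
      map_add' := map_add g
      map_smul' := hgx }
  rcases LinearMap.bijective_or_eq_zero g' with h | h
  · exfalso
    set w := b.equivFun.symm v
    have hw : b.repr w = (v : Fin d → ℝ) := b.equivFun.apply_symm_apply _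
    have hBg : LinearMap.toMatrix b b g = B := LinearMap.toMatrixAlgEquiv_toLinAlgEquiv b B
    have hgw : g w = 0 := by
      have := LinearMap.toMatrix_mulVec_repr b b g w
      rw [hBg, hw, hB, Matrix.sub_mulVec, hv, Matrix.smul_mulVec, Matrix.one_mulVec,
        sub_self] at this
      rw [← b.repr.map_eq_zero_iff]
      ext i
      exact (congrFun this i).symm
    have hw0 : w = 0 := h.1 (hgw.trans (map_zero g).symm)
    rw [hw0, map_zero] at hw
    exact hv0 (by ext i; exact (congrFun hw i).symm)
  · refine ⟨c, sub_eq_zero.1 ((Matrix.toLinAlgEquiv b).injective ?_)⟩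
    rw [map_zero]
    ext1 w
    exact LinearMap.congr_fun h w

end Reduction

/-! ### The three cases -/

section Cases

/-- In a basis of `Δ` for which the summand of index `0` is isometrically embedded in `ℝ^N`, the
elements `e₀ eᵢ` act by anticommuting skew complex structures `J i` (the action on `ℝ^N` is skew by
hypothesis). The symmetric elements of their commutant are scalars, and every model of the commutant
as a star algebra describes the centralizer. -/
theorem exists_complexStructures_of_so {n m : ℕ} [NeZero m] {Δ : Type*} [AddCommGroup Δ]
    [Module ℝ Δ] [Module (EvenCl (n + 1)) Δ] [IsScalarTower ℝ (EvenCl (n + 1)) Δ]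
    [IsSimpleModule (EvenCl (n + 1)) Δ]
    (ψ : (Δ ⊗[ℝ] (Fin m → ℝ)) ≃ₗ[ℝ] (Fin (Module.finrank ℝ Δ * m) → ℝ))
    (hso : spinHat (r := n + 1) ψ ≤
      LieAlgebra.Orthogonal.so (Fin (Module.finrank ℝ Δ * m)) ℝ) :
    0 < Module.finrank ℝ Δ ∧
    ∃ J : Fin n → Matrix (Fin (Module.finrank ℝ Δ)) (Fin (Module.finrank ℝ Δ)) ℝ,
      (∀ i, J i * J i = -1) ∧ (∀ i, (J i)ᵀ = -J i) ∧
      (∀ i j, i ≠ j → J i * J j = -(J j * J i)) ∧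
      (∀ A ∈ commutant J, Aᵀ = A → ∃ c : ℝ, A = c • 1) ∧
      ∀ (A : Type) [Ring A] [StarRing A] [Algebra ℝ A] [StarModule ℝ A]
        (φ : A →ₐ[ℝ] Matrix (Fin (Module.finrank ℝ Δ)) (Fin (Module.finrank ℝ Δ)) ℝ),
        IsCommutantModel A J φ →
        Nonempty (centralizerIn (LieAlgebra.Orthogonal.so (Fin (Module.finrank ℝ Δ * m)) ℝ)
          (spinHat (r := n + 1) ψ) ≃ₗ⁅ℝ⁆ skewHermitian m A) := by
  have : Nontrivial Δ := IsSimpleModule.nontrivial (EvenCl (n + 1)) Δ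
  -- Finiteness of `Δ` comes from its embedding into `ℝ^N`, available because `m ≠ 0`.
  have : FiniteDimensional ℝ Δ :=
    FiniteDimensional.of_injective (summand ψ 0) (summand_injective ψ 0)
  have hd : 0 < Module.finrank ℝ Δ := Module.finrank_pos
  have : NeZero (Module.finrank ℝ Δ) := ⟨hd.ne'⟩
  obtain ⟨b, hb⟩ := exists_basis_orthonormal_summand ψ 0
  set S := fun a => LinearMap.toMatrix b (Pi.basisFun ℝ _) (summand ψ a)
  have hSapp : ∀ a x i, S a x i = summand ψ a (b i) x := fun a x i => by
    simp [S, LinearMap.toMatrix_apply]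
  have hS : ∀ a (x : EvenCl (n + 1)), diagRep ψ x * S a = S a * matrixRep b x :=
    fun a x => diagRep_mul_summand b ψ a x
  have hS0 : (S 0)ᵀ * S 0 = 1 := by
    ext i j
    rw [Matrix.mul_apply, Matrix.one_apply, ← hb]
    simp [dotProduct, hSapp]
  set J : Fin n → Matrix (Fin (Module.finrank ℝ Δ)) (Fin (Module.finrank ℝ Δ)) ℝ :=
    fun i => matrixRep b (bivec 0 i.succ) with hJdef
  have hK : ∀ i : Fin n, (diagRep (r := n + 1) ψ (bivec 0 i.succ))ᵀ =
      -diagRep ψ (bivec 0 i.succ) := fun i =>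
    (LieAlgebra.Orthogonal.mem_so _ _ _).1
      (hso ⟨bivec 0 i.succ, bivec_mem (Fin.succ_ne_zero i).symm, rfl⟩)
  have hJ : ∀ i, (J i)ᵀ = -J i := fun i => by
    have h1 : J i = (S 0)ᵀ * (diagRep ψ (bivec 0 i.succ) * S 0) := by
      rw [hS, ← Matrix.mul_assoc, hS0, Matrix.one_mul]
    rw [h1, Matrix.transpose_mul, Matrix.transpose_mul, hK, Matrix.transpose_transpose,
      Matrix.mul_neg, Matrix.neg_mul, Matrix.mul_assoc]
  have hsymm : ∀ A ∈ commutant J, Aᵀ = A → ∃ c : ℝ, A = c • 1 :=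
    fun A hA hAt => exists_eq_smul_one_of_symmetric b hA hAt
  have hcard : Fintype.card (Fin (Module.finrank ℝ Δ * m)) =
    Fintype.card (Fin (Module.finrank ℝ Δ)) * m := by simp
  have hspan : ∀ y, (∀ a, y ᵥ* S a = 0) → y = 0 := by
    intro y hy
    refine dotProduct_eq_zero_of_summand ψ fun a v => ?_
    rw [← b.sum_repr v, map_sum, dotProduct_sum]
    refine Finset.sum_eq_zero fun i _ => ?_
    have := congrFun (hy a) i
    simp only [Matrix.vecMul, hSapp] at this
    rw [map_smul, dotProduct_smul]
    exact smul_eq_zero_of_right _ this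
  refine ⟨hd, J, fun i => ?_, hJ, fun i j hij => ?_, hsymm, ?_⟩
  · rw [hJdef, ← map_mul, bivec_zero_succ_sq, map_neg, map_one]
  · simp only [hJdef]
    rw [← map_mul, bivec_zero_succ_anticomm hij, map_neg, map_mul]
  · intro A _ _ _ _ φ hφ
    obtain ⟨T, hT, hTT⟩ := exists_orthonormal_intertwiners hcard hK hJ hsymm
      (fun a i => hS a (bivec 0 i.succ)) hspan m le_rfl
    exact nonempty_lieEquiv_skewHermitian hφ hcard hT hTT _ (mem_centralizerIn_spinHat ψ)

/-- Periodicity modulo 8, from `(1 + i) ^ 8 = 16`. -/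
theorem one_add_I_pow_re (q s : ℕ) :
    ((1 + Complex.I) ^ (8 * q + s)).re = 16 ^ q * ((1 + Complex.I) ^ s).re := by
  have h2 : (1 + Complex.I) ^ 2 = 2 * Complex.I := by
    linear_combination Complex.I_sq
  have h8 : (1 + Complex.I) ^ 8 = ((16 : ℝ) : ℂ) := by
    rw [show 8 = 2 * 4 from rfl, pow_mul, h2, mul_pow, Complex.I_pow_four]
    norm_num
  rw [pow_add, pow_mul, h8, ← Complex.ofReal_pow, Complex.re_ofReal_mul]

theorem one_add_I_pow_re_pos {r : ℕ} (h : r % 8 = 1 ∨ r % 8 = 7) :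
    0 < ((1 + Complex.I) ^ r).re := by
  rw [← Nat.div_add_mod r 8, one_add_I_pow_re]
  refine mul_pos (by positivity) ?_
  rcases h with h | h <;> rw [h] <;> norm_num [pow_succ]

theorem one_add_I_pow_re_eq_zero {r : ℕ} (h : r % 8 = 2 ∨ r % 8 = 6) :
    ((1 + Complex.I) ^ r).re = 0 := by
  rw [← Nat.div_add_mod r 8, one_add_I_pow_re]
  refine mul_eq_zero_of_right _ ?_
  rcases h with h | h <;> rw [h] <;> norm_num [pow_succ]

theorem one_add_I_pow_re_neg {r : ℕ} (h : r % 8 = 3 ∨ r % 8 = 5) :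
    ((1 + Complex.I) ^ r).re < 0 := by
  rw [← Nat.div_add_mod r 8, one_add_I_pow_re]
  refine mul_neg_of_pos_of_neg (by positivity) ?_
  rcases h with h | h <;> rw [h] <;> norm_num [pow_succ]

theorem skewHermitian_real (m : ℕ) :
    skewHermitian m ℝ = LieAlgebra.Orthogonal.so (Fin m) ℝ := by
  ext X
  rw [LieAlgebra.Orthogonal.mem_so, ← Matrix.conjTranspose_eq_transpose_of_trivial]
  rfl

theorem nonempty_lieEquiv_of_subsingleton (L M : Type*) [LieRing L] [LieAlgebra ℝ L] [LieRing M]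
    [LieAlgebra ℝ M] [Subsingleton L] [Subsingleton M] : Nonempty (L ≃ₗ⁅ℝ⁆ M) :=
  ⟨LieEquiv.ofBijective 0 ⟨Function.injective_of_subsingleton _,
    fun _ => ⟨0, Subsingleton.elim _ _⟩⟩⟩

end Cases

end SpinCentralizer

theorem theorem1 (r m : ℕ) (hr : 1 < r) (hr4 : ¬ r % 4 = 0)
    (Δ : Type*) [AddCommGroup Δ] [Module ℝ Δ] [Module (SpinCentralizer.EvenCl r) Δ]
    [IsScalarTower ℝ (SpinCentralizer.EvenCl r) Δ] [IsSimpleModule (SpinCentralizer.EvenCl r) Δ]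
    (ψ : (Δ ⊗[ℝ] (Fin m → ℝ)) ≃ₗ[ℝ] (Fin (Module.finrank ℝ Δ * m) → ℝ))
    (hso : SpinCentralizer.spinHat (r := r) ψ ≤
      LieAlgebra.Orthogonal.so (Fin (Module.finrank ℝ Δ * m)) ℝ) :
    ((r % 8 = 1 ∨ r % 8 = 7) →
      Nonempty (SpinCentralizer.centralizerIn
          (LieAlgebra.Orthogonal.so (Fin (Module.finrank ℝ Δ * m)) ℝ)
          (SpinCentralizer.spinHat (r := r) ψ) ≃ₗ⁅ℝ⁆ LieAlgebra.Orthogonal.so (Fin m) ℝ)) ∧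
    ((r % 8 = 2 ∨ r % 8 = 6) →
      Nonempty (SpinCentralizer.centralizerIn
          (LieAlgebra.Orthogonal.so (Fin (Module.finrank ℝ Δ * m)) ℝ)
          (SpinCentralizer.spinHat (r := r) ψ) ≃ₗ⁅ℝ⁆ SpinCentralizer.u m)) ∧
    ((r % 8 = 3 ∨ r % 8 = 5) →
      Nonempty (SpinCentralizer.centralizerIn
          (LieAlgebra.Orthogonal.so (Fin (Module.finrank ℝ Δ * m)) ℝ)
          (SpinCentralizer.spinHat (r := r) ψ) ≃ₗ⁅ℝ⁆ SpinCentralizer.sp m)) := by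
  obtain ⟨n, rfl⟩ : ∃ n, r = n + 1 := ⟨r - 1, by omega⟩
  -- For `m = 0` both Lie algebras consist of empty matrices.
  rcases Nat.eq_zero_or_pos m with rfl | hm
  · have : IsEmpty (Fin (Module.finrank ℝ Δ * 0)) := Fin.isEmpty
    exact ⟨fun _ => SpinCentralizer.nonempty_lieEquiv_of_subsingleton _ _,
      fun _ => SpinCentralizer.nonempty_lieEquiv_of_subsingleton _ _,
      fun _ => SpinCentralizer.nonempty_lieEquiv_of_subsingleton _ _⟩
  have : NeZero m := ⟨hm.ne'⟩
  obtain ⟨hd, J, hsq, hskew, hanti, hsymm, hmodel⟩ :=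
    SpinCentralizer.exists_complexStructures_of_so ψ hso
  have : Nonempty (Fin (Module.finrank ℝ Δ)) := ⟨⟨0, hd⟩⟩
  have hdim := SpinCentralizer.finrank_commutant hsq hskew hanti hsymm
  have hpos : 0 < Module.finrank ℝ (SpinCentralizer.commutant J) := Module.finrank_pos
  rw [Fintype.card_fin, mul_div_right_comm] at hdim
  have hc : (0 : ℝ) < (Module.finrank ℝ Δ : ℝ) / 2 ^ n := by positivity
  refine ⟨fun h => ?_, fun h => ?_, fun h => ?_⟩
  · have h1 := mul_pos hc (SpinCentralizer.one_add_I_pow_re_pos h)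
    have h2 : Module.finrank ℝ (SpinCentralizer.commutant J) < 2 := by
      have : (Module.finrank ℝ (SpinCentralizer.commutant J) : ℝ) < (2 : ℕ) := by
        push_cast
        linarith
      exact_mod_cast this
    obtain ⟨φ, hφ⟩ := SpinCentralizer.exists_model_real (J := J) (by omega)
    rw [← SpinCentralizer.skewHermitian_real m]
    exact hmodel ℝ φ hφ
  · rw [SpinCentralizer.one_add_I_pow_re_eq_zero h, mul_zero, sub_zero] at hdim
    obtain ⟨φ, hφ⟩ := SpinCentralizer.exists_model_complex hskew hsymm (by exact_mod_cast hdim)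
    exact hmodel ℂ φ hφ
  · have h1 := mul_neg_of_pos_of_neg hc (SpinCentralizer.one_add_I_pow_re_neg h)
    have h2 : 2 < Module.finrank ℝ (SpinCentralizer.commutant J) := by
      have : ((2 : ℕ) : ℝ) < (Module.finrank ℝ (SpinCentralizer.commutant J) : ℝ) := by
        push_cast
        linarith
      exact_mod_cast this
    obtain ⟨φ, hφ⟩ := SpinCentralizer.exists_model_quaternion hskew hsymm h2
    exact hmodel ℍ[ℝ] φ hφ
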